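/- Let $\mathcal X$ and $\mathcal Y$ be finite alphabets with $\mathcal X\neq\emptyset$. A general channel is a sequence $\mathbf W=\{W^n\}_{n\ge1}$ of arbitrary conditional probability distributions $W^n(y^n|x^n)$, $x^n\in\mathcal X^n$, $y^n\in\mathcal Y^n$ (no consistency, stationarity or ergodicity is assumed). For a positive integer $N$, an identification code with $N$ messages for $W^n$ is a family $\{(Q_i,\mathcal D_i)\}_{i=1}^{N}$ of probability distributions $Q_i$ on $\mathcal X^n$ and (not necessarily disjoint) sets $\mathcal D_i\subseteq\mathcal Y^n$. Its maximal error probabilities of the first and second kind are $$\varepsilon_n=\max_{i}\Bigl(1-\sum_{x^n}Q_i(x^n)W^n(\mathcal D_i|x^n)\Bigr),\qquad \delta_n=\max_{i\ne j}\sum_{x^n}Q_j(x^n)W^n(\mathcal D_i|x^n),$$ where $\delta_n=0$ if $N=1$. A real number $R$ is an achievable identification rate for $\mathbf W$ if for every $n$ there is an identification code for $W^n$, with $N_n\ge 1$ messages and maximal error probabilities $\varepsilon_n,\delta_n$, such that $$\limsup_{n\to\infty}\varepsilon_n\le 0,\qquad \limsup_{n\to\infty}\delta_n\le 0,\qquad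 \liminf_{n\to\infty}\frac1n\log\log N_n\ge R,$$ where a code with a single message is given rate $0$, i.e. $\log\log 1:=0$. The identification capacity $C_{\mathrm{ID}}(\mathbf W)$ is the supremum of all achievable identification rates. For a sequence $\mathbf X=\{X^n\}_{n\ge1}$ of random variables, $X^n$ having an arbitrary distribution on $\mathcal X^n$, let $\mathbf Y=\{Y^n\}_{n\ge1}$ be the corresponding outputs, so that $(X^n,Y^n)$ has the joint distribution $P_{X^n}(x^n)W^n(y^n|x^n)$, and let $$\underline I(\mathbf X;\mathbf Y)=\sup\Bigl\{a\in\mathbb R:\ \lim_{n\to\infty}\mathbb P\Bigl(\frac1n\log\frac{W^n(Y^n|X^n)}{P_{Y^n}(Y^n)}\le a\Bigr)=0\Bigr\}$$ be the spectral-inf mutual information rate. All logarithms are natural. Then for every general channel $\mathbf W$ with these finite alphabets, with no strong-converse assumption, $$C_{\mathrm{ID}}(\mathbf W)=\sup_{\mathbf X}\underline I(\mathbf X;\mathbf Y),$$ where the supremum is over all sequences $\mathbf X$ of inputs. -/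

import Mathlib

open Filter Topology

noncomputable section

/-- A channel from `A` to `B`: `W x y` is the conditional probability of the output `y` given the
input `x`. -/
abbrev Channel (A B : Type*) [Fintype B] := A → stdSimplex ℝ B

/-- A general channel with input alphabet `X` and output alphabet `Y`: an arbitrary sequence of
channels `W n` from `X^n` to `Y^n`. (The spaces of words of length `0` have one point, so `W 0`
carries no information.) -/
abbrev GeneralChannel (X Y : Type*) [Fintype Y] := (n : ℕ) → Channel (Fin n → X) (Fin n → Y)

/-- A sequence of input distributions: an arbitrary distribution of `X^n` for every `n`. No
consistency between different block lengths is required. -/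
abbrev InputSequence (X : Type*) [Fintype X] := (n : ℕ) → stdSimplex ℝ (Fin n → X)

/-- The output distribution `PW(y) = ∑ x, P(x) W(y|x)`. -/
def outputDist {A B : Type*} [Fintype A] [Fintype B]
    (P : stdSimplex ℝ A) (W : Channel A B) (y : B) : ℝ :=
  ∑ x, P x * W x y

/-- The probability, under the joint distribution `P(x) W(y|x)`, that the normalized information
density `(1/n) log (W(y|x) / PW(y))` is at most `a`. Both `W(y|x)` and `PW(y)` are positive at every
pair of positive joint probability. -/
def infoDensityCDF {A B : Type*} [Fintype A] [Fintype B]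
    (P : stdSimplex ℝ A) (W : Channel A B) (n : ℕ) (a : ℝ) : ℝ :=
  ∑ x, ∑ y,
    if (1 / (n : ℝ)) * Real.log (W x y / outputDist P W y) ≤ a then P x * W x y else 0

/-- The spectral-inf mutual information rate of the input sequence `P` and the corresponding
output sequence through `W`. -/
def spectralInfMutualInfo {X Y : Type*} [Fintype X] [Fintype Y]
    (P : InputSequence X) (W : GeneralChannel X Y) : EReal :=
  sSup ((fun a : ℝ => (a : EReal)) ''
    {a : ℝ | Tendsto (fun n : ℕ => infoDensityCDF (P n) (W n) n a) atTop (𝓝 0)})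

/-- A randomized identification code with `N` messages for inputs in `A` and outputs in `B`: a
distribution on the inputs and a decoding set for every message. The decoding sets may overlap. -/
structure IDCode (A B : Type*) [Fintype A] (N : ℕ) where
  encoder : Fin N → stdSimplex ℝ A
  decodingSet : Fin N → Finset B

namespace IDCode

variable {A B : Type*} [Fintype A] [Fintype B] {N : ℕ}

/-- The probability that the receiver interested in message `i` accepts when `j` is sent. -/
def acceptProb (c : IDCode A B N) (W : Channel A B) (i j : Fin N) : ℝ :=
  ∑ x, c.encoder j x * ∑ y ∈ c.decodingSet i, W x y

/-- The maximal error probability of the first kind. -/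
def errorI (c : IDCode A B N) (W : Channel A B) : ℝ :=
  ⨆ i : Fin N, (1 - c.acceptProb W i i)

/-- The maximal error probability of the second kind (`0` if there is only one message). -/
def errorII (c : IDCode A B N) (W : Channel A B) : ℝ :=
  ⨆ p : {p : Fin N × Fin N // p.1 ≠ p.2}, c.acceptProb W p.1.1 p.1.2

end IDCode

/-- The rate `(1/n) log log N` of an identification code. As `Real.log 0 = 0`, a code with the
single message `N = 1` has rate `0`. -/
def idRate (n N : ℕ) : ℝ := (1 / (n : ℝ)) * Real.log (Real.log (N : ℝ))

/-- `R` is an `(ε, δ)`-achievable identification rate for the general channel `W`. -/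
def IDAchievable {X Y : Type*} [Fintype X] [Fintype Y]
    (ε δ : ℝ) (W : GeneralChannel X Y) (R : ℝ) : Prop :=
  ∃ (N : ℕ → ℕ) (c : (n : ℕ) → IDCode (Fin n → X) (Fin n → Y) (N n)),
    (∀ n, 1 ≤ N n) ∧
    limsup (fun n => (((c n).errorI (W n) : ℝ) : EReal)) atTop ≤ (ε : EReal) ∧
    limsup (fun n => (((c n).errorII (W n) : ℝ) : EReal)) atTop ≤ (δ : EReal) ∧
    (R : EReal) ≤ liminf (fun n => ((idRate n (N n) : ℝ) : EReal)) atTop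

/-- The `(ε, δ)`-identification capacity: the supremum of the `(ε, δ)`-achievable rates. -/
def idCapacityAt {X Y : Type*} [Fintype X] [Fintype Y]
    (ε δ : ℝ) (W : GeneralChannel X Y) : EReal :=
  sSup ((fun R : ℝ => (R : EReal)) '' {R : ℝ | IDAchievable ε δ W R})

/-- The identification capacity, the case `ε = δ = 0`. -/
def idCapacity {X Y : Type*} [Fintype X] [Fintype Y] (W : GeneralChannel X Y) : EReal :=
  idCapacityAt 0 0 W

end

/-! Converse. Fix a reference output law `Q` and keep only the part of the channel where `W ≤ L *
Q`. By a second-moment argument (`exists_soft_covering`), the truncated output of each encoder is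
imitated on all events by a word of `K` inputs, with error `√(L / K)`. With more messages than
words, two messages `i`, `j` share a word, so their truncated outputs nearly agree. For `i` this
truncated mass is at most the first-kind error off the decoding set of `i`, and nearly at most the
second-kind error on it. Hence it is small, and no strong converse enters.

The input law so obtained depends on `Q`. Replacing the truncation by `min (W x y) (l * Q y)`,
linear in the input law and concave in `Q`, lets Sion's minimax theorem exchange the quantifiers.
One input law then works for every `Q`, in particular for its own output law, and this bounds its
information-density distribution function by the two errors plus vanishing terms.

Direct part. Feinstein's lemma gives `s * q` inputs with disjoint decoding sets, indexed by pairs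
(position, letter). A Gilbert–Varshamov code of words of length `s` over `q` letters turns them into
an identification code: a message sends a uniformly random position of its word together with the
letter there. Two words rarely agree, and at least `2 ^ s` words survive, so the identification rate
is essentially `(1/n) log s`. -/

/-! ### Soft covering by a second-moment argument -/

theorem stdSimplex.exists_le_sum_mul {A : Type*} [Fintype A] (P : stdSimplex ℝ A) (f : A → ℝ) :
    ∃ x, f x ≤ ∑ x, P x * f x := by
  by_contra! h
  have h1 : ∑ x, P x * (∑ x, P x * f x) = ∑ x, P x * f x := by
    rw [← Finset.sum_mul, stdSimplex.sum_eq_one P, one_mul]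
  have hle : ∀ x ∈ Finset.univ, P x * f x ≤ P x * (∑ x, P x * f x) := by
    refine (Finset.sum_eq_sum_iff_of_le fun x _ => ?_).1 h1 |> fun h x hx => (h x hx).ge
    exact mul_le_mul_of_nonneg_left (h x).le (stdSimplex.zero_le P x)
  have hz : ∀ x, P x = 0 := fun x => by
    by_contra hx
    have := le_of_mul_le_mul_left (hle x (Finset.mem_univ x))
      (lt_of_le_of_ne (stdSimplex.zero_le P x) (Ne.symm hx))
    exact absurd (h x) this.not_gt
  have := stdSimplex.sum_eq_one P
  simp [hz] at this

/-- Variances of independent centred samples add. The samples are picked one at a time: on average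
over the new one the cross term vanishes, so some choice adds at most `σ`. -/
theorem exists_sum_mul_sq_sum_le {A ι : Type*} [Fintype A] [Fintype ι] (P : stdSimplex ℝ A)
    (v : A → ι → ℝ) (w : ι → ℝ) (hv : ∀ i, ∑ x, P x * v x i = 0) {σ : ℝ}
    (hσ : ∑ x, P x * ∑ i, w i * v x i ^ 2 ≤ σ) (K : ℕ) :
    ∃ u : Fin K → A, ∑ i, w i * (∑ k, v (u k) i) ^ 2 ≤ K * σ := by
  induction K with
  | zero => exact ⟨Fin.elim0, by simp⟩
  | succ K ih =>
    obtain ⟨u, hu⟩ := ih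
    set S : ι → ℝ := fun i => ∑ k, v (u k) i with hS
    obtain ⟨x, hx⟩ := stdSimplex.exists_le_sum_mul P fun x => ∑ i, w i * (v x i + S i) ^ 2
    refine ⟨Fin.cons x u, ?_⟩
    have hsq : ∑ x, P x * ∑ i, w i * (v x i + S i) ^ 2
        = ∑ x, P x * ∑ i, w i * v x i ^ 2 + ∑ i, w i * S i ^ 2 := by
      have h1 : ∀ x, P x * ∑ i, w i * (v x i + S i) ^ 2
          = P x * ∑ i, w i * v x i ^ 2 + ∑ i, 2 * w i * S i * (P x * v x i)
            + P x * ∑ i, w i * S i ^ 2 := fun x => by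
        simp only [Finset.mul_sum, ← Finset.sum_add_distrib]
        exact Finset.sum_congr rfl fun i _ => by ring
      simp only [h1, Finset.sum_add_distrib]
      rw [Finset.sum_comm, ← Finset.sum_mul, stdSimplex.sum_eq_one P]
      simp [← Finset.mul_sum, hv]
    simp only [Fin.sum_univ_succ, Fin.cons_zero, Fin.cons_succ]
    push_cast
    rw [hsq] at hx
    linarith

/-- Soft covering: a subchannel `V` dominated by `L * Q` is simulated by `K` equally likely inputs
up to an error `√(L / K)` on every event. -/
theorem exists_soft_covering {A B : Type*} [Fintype A] [Fintype B] (P : stdSimplex ℝ A)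
    (Q : stdSimplex ℝ B) (V : A → B → ℝ) {L : ℝ} (hV0 : ∀ x y, 0 ≤ V x y)
    (hVL : ∀ x y, V x y ≤ L * Q y) (hL : 0 ≤ L) (hV1 : ∀ x, ∑ y, V x y ≤ 1)
    {K : ℕ} (hK : 0 < K) :
    ∃ u : Fin K → A, ∀ D : Finset B,
      |(∑ y ∈ D, ∑ k, V (u k) y) / K - ∑ y ∈ D, ∑ x, P x * V x y| ≤ √(L / K) := by
  set m : B → ℝ := fun y => ∑ x, P x * V x y with hm
  have hK' : (0 : ℝ) < K := by exact_mod_cast hK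
  -- Chi-square weighting: `V ≤ L * Q` gives `V ^ 2 / Q ≤ L * V`, and each `V x` has mass at most 1.
  have hvar : ∑ x, P x * ∑ y, (Q y)⁻¹ * (V x y - m y) ^ 2 ≤ L := by
    have h1 : ∀ y, ∑ x, P x * (V x y - m y) ^ 2 ≤ ∑ x, P x * V x y ^ 2 := fun y => by
      have : ∑ x, P x * (V x y - m y) ^ 2 = ∑ x, P x * V x y ^ 2 - m y ^ 2 := by
        have h2 : ∀ x, P x * (V x y - m y) ^ 2
          = P x * V x y ^ 2 - 2 * m y * (P x * V x y) + P x * m y ^ 2 := fun x => by ring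
        simp only [h2, Finset.sum_add_distrib, Finset.sum_sub_distrib, ← Finset.mul_sum,
          ← Finset.sum_mul, stdSimplex.sum_eq_one P]
        rw [show ∑ x, P x * V x y = m y from rfl]
        ring
      rw [this]
      linarith [sq_nonneg (m y)]
    have h3 : ∀ x y, (Q y)⁻¹ * V x y ^ 2 ≤ L * V x y := fun x y => by
      rcases (stdSimplex.zero_le Q y).eq_or_lt with h | h
      · rw [← h]
        simpa using mul_nonneg hL (hV0 x y)
      · rw [inv_mul_le_iff₀ h]
        nlinarith [hVL x y, hV0 x y]
    calc ∑ x, P x * ∑ y, (Q y)⁻¹ * (V x y - m y) ^ 2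
        = ∑ y, (Q y)⁻¹ * ∑ x, P x * (V x y - m y) ^ 2 := by
          simp only [Finset.mul_sum]
          rw [Finset.sum_comm]
          exact Finset.sum_congr rfl fun _ _ => Finset.sum_congr rfl fun _ _ => by ring
      _ ≤ ∑ y, (Q y)⁻¹ * ∑ x, P x * V x y ^ 2 := Finset.sum_le_sum fun y _ =>
          mul_le_mul_of_nonneg_left (h1 y) (inv_nonneg.2 (stdSimplex.zero_le Q y))
      _ = ∑ x, P x * ∑ y, (Q y)⁻¹ * V x y ^ 2 := by
          simp only [Finset.mul_sum]
          rw [Finset.sum_comm]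
          exact Finset.sum_congr rfl fun _ _ => Finset.sum_congr rfl fun _ _ => by ring
      _ ≤ ∑ x, P x * L := Finset.sum_le_sum fun x _ => by
          refine mul_le_mul_of_nonneg_left ?_ (stdSimplex.zero_le P x)
          calc ∑ y, (Q y)⁻¹ * V x y ^ 2 ≤ ∑ y, L * V x y := Finset.sum_le_sum fun y _ => h3 x y
            _ = L * ∑ y, V x y := by rw [Finset.mul_sum]
            _ ≤ L := mul_le_of_le_one_right hL (hV1 x)
      _ = L := by rw [← Finset.sum_mul, stdSimplex.sum_eq_one P, one_mul]
  obtain ⟨u, hu⟩ := exists_sum_mul_sq_sum_le P (fun x y => V x y - m y) (fun y => (Q y)⁻¹)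
    (fun y => by
      simp only [mul_sub, Finset.sum_sub_distrib, ← Finset.sum_mul, stdSimplex.sum_eq_one P]
      simp [hm]) hvar K
  refine ⟨u, fun D => ?_⟩
  set S : B → ℝ := fun y => ∑ k, (V (u k) y - m y) with hS
  -- Where `Q` vanishes the weight `(Q y)⁻¹` is 0, so the weighted variance does not see `S` there;
  -- domination forces `S` to vanish anyway.
  have hS0 : ∀ y, Q y = 0 → S y = 0 := fun y hy => by
    have hz : ∀ x, V x y = 0 := fun x => le_antisymm (by simpa [hy] using hVL x y) (hV0 x y)
    simp [hS, hm, hz]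
  have hD : (∑ y ∈ D, S y) ^ 2 ≤ K * L := by
    -- Cauchy–Schwarz for `S = √Q * (S / √Q)`; it is uniform in the event `D`.
    have h1 : (∑ y ∈ D, S y) ^ 2 ≤ (∑ y ∈ D, Q y) * ∑ y ∈ D, (Q y)⁻¹ * S y ^ 2 := by
      refine Finset.sum_sq_le_sum_mul_sum_of_sq_le_mul D (fun y _ => stdSimplex.zero_le Q y)
        (fun y _ => mul_nonneg (inv_nonneg.2 (stdSimplex.zero_le Q y)) (sq_nonneg _)) fun y _ => ?_
      by_cases h : Q y = 0
      · simp [hS0 y h, h]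
      · exact le_of_eq (by field_simp)
    have h2 : ∑ y ∈ D, Q y ≤ 1 := by
      rw [← stdSimplex.sum_eq_one Q]
      exact Finset.sum_le_sum_of_subset_of_nonneg (Finset.subset_univ _) fun y _ _ => stdSimplex.zero_le Q y
    have h3 : ∑ y ∈ D, (Q y)⁻¹ * S y ^ 2 ≤ ∑ y, (Q y)⁻¹ * S y ^ 2 :=
      Finset.sum_le_sum_of_subset_of_nonneg (Finset.subset_univ _) fun y _ _ =>
        mul_nonneg (inv_nonneg.2 (stdSimplex.zero_le Q y)) (sq_nonneg _)
    have h4 : 0 ≤ ∑ y ∈ D, (Q y)⁻¹ * S y ^ 2 := Finset.sum_nonneg fun y _ =>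
      mul_nonneg (inv_nonneg.2 (stdSimplex.zero_le Q y)) (sq_nonneg _)
    nlinarith
  have hdiff : (∑ y ∈ D, ∑ k, V (u k) y) / K - ∑ y ∈ D, m y = (∑ y ∈ D, S y) / K := by
    simp only [hS, Finset.sum_sub_distrib, Finset.sum_const, Finset.card_univ, Fintype.card_fin,
      nsmul_eq_mul, ← Finset.mul_sum]
    field_simp
  rw [hdiff]
  refine Real.abs_le_sqrt ?_
  rw [div_pow, div_le_div_iff₀ (by positivity) hK']
  nlinarith

/-! ### One-shot converse: pigeonhole and minimax -/

namespace IDCode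

variable {A B : Type*} [Fintype A] [Fintype B] {N : ℕ}

theorem one_sub_acceptProb_le_errorI (c : IDCode A B N) (W : Channel A B) (i : Fin N) :
    1 - c.acceptProb W i i ≤ c.errorI W :=
  le_ciSup (f := fun i => 1 - c.acceptProb W i i) (Set.finite_range _).bddAbove i

theorem acceptProb_le_errorII (c : IDCode A B N) (W : Channel A B) {i j : Fin N} (h : i ≠ j) :
    c.acceptProb W i j ≤ c.errorII W :=
  le_ciSup (f := fun p : {p : Fin N × Fin N // p.1 ≠ p.2} => c.acceptProb W p.1.1 p.1.2)
    (Set.finite_range _).bddAbove ⟨(i, j), h⟩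

theorem acceptProb_eq_sum (c : IDCode A B N) (W : Channel A B) (i j : Fin N) :
    c.acceptProb W i j = ∑ y ∈ c.decodingSet i, ∑ x, c.encoder j x * W x y := by
  unfold acceptProb
  simp only [Finset.mul_sum]
  rw [Finset.sum_comm]

/-- If there are more messages than words of `K` inputs, then for every reference distribution `Q`
some input distribution makes the event `W ≤ L * Q` unlikely. -/
theorem exists_sum_ite_le (c : IDCode A B N) (W : Channel A B) {K : ℕ} (hK : 0 < K)
    (hN : Fintype.card A ^ K < N) (Q : stdSimplex ℝ B) {L : ℝ} (hL : 0 ≤ L) :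
    ∃ P : stdSimplex ℝ A, ∑ x, ∑ y, P x * (if W x y ≤ L * Q y then W x y else 0)
      ≤ c.errorI W + c.errorII W + 2 * √(L / K) := by
  classical
  set V : A → B → ℝ := fun x y => if W x y ≤ L * Q y then W x y else 0 with hV
  have hV0 : ∀ x y, 0 ≤ V x y := fun x y => by
    simp only [hV]; split_ifs
    exacts [stdSimplex.zero_le _ _, le_rfl]
  have hVW : ∀ x y, V x y ≤ W x y := fun x y => by
    simp only [hV]; split_ifs
    exacts [le_rfl, stdSimplex.zero_le _ _]
  have hVL : ∀ x y, V x y ≤ L * Q y := fun x y => by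
    simp only [hV]; split_ifs with h
    exacts [h, mul_nonneg hL (stdSimplex.zero_le _ _)]
  have hV1 : ∀ x, ∑ y, V x y ≤ 1 := fun x => by
    rw [← stdSimplex.sum_eq_one (W x)]
    exact Finset.sum_le_sum fun y _ => hVW x y
  choose u hu using fun i => exists_soft_covering (c.encoder i) Q V hV0 hVL hL hV1 hK
  -- There are only `card A ^ K` words, so two messages are simulated by the same one.
  obtain ⟨i, j, hij, huij⟩ := Fintype.exists_ne_map_eq_of_card_lt u (by simpa using hN)
  refine ⟨c.encoder i, ?_⟩
  set D := c.decodingSet i with hD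
  have hmono : ∀ k (E : Finset B), ∑ y ∈ E, ∑ x, c.encoder k x * V x y
      ≤ ∑ y ∈ E, ∑ x, c.encoder k x * W x y := fun k E =>
    Finset.sum_le_sum fun y _ => Finset.sum_le_sum fun x _ =>
      mul_le_mul_of_nonneg_left (hVW x y) (stdSimplex.zero_le _ _)
  have htotal : ∑ y ∈ D, ∑ x, c.encoder i x * W x y + ∑ y ∈ Dᶜ, ∑ x, c.encoder i x * W x y = 1 := by
    rw [Finset.sum_add_sum_compl, Finset.sum_comm]
    simp only [← Finset.mul_sum, stdSimplex.sum_eq_one, mul_one]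
  have hI := c.one_sub_acceptProb_le_errorI W i
  have hII := c.acceptProb_le_errorII W hij
  rw [acceptProb_eq_sum] at hI hII
  have hi := abs_le.1 (hu i D)
  have hj := abs_le.1 (hu j D)
  rw [huij] at hi
  have h1 := hmono i Dᶜ
  have h2 := hmono j D
  rw [Finset.sum_comm, ← Finset.sum_add_sum_compl D]
  linarith [hi.1, hj.2]

end IDCode

/-- Minimax form of the choice of an input distribution: one that is good against every reference
output distribution exists as soon as each reference distribution has a good input distribution. -/
theorem exists_forall_sum_min_le {A B : Type*} [Fintype A] [Fintype B] [Nonempty A] [Nonempty B]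
    (W : Channel A B) {l κ : ℝ}
    (h : ∀ Q : stdSimplex ℝ B, ∃ P : stdSimplex ℝ A,
      ∑ x, ∑ y, P x * min (W x y) (l * Q y) ≤ κ) :
    ∃ P : stdSimplex ℝ A, ∀ Q : stdSimplex ℝ B, ∑ x, ∑ y, P x * min (W x y) (l * Q y) ≤ κ := by
  let f : (A → ℝ) → (B → ℝ) → ℝ := fun p q => ∑ x, ∑ y, p x * min (W x y) (l * q y)
  have hconv : ∀ q, ConvexOn ℝ (stdSimplex ℝ A) fun p => f p q := fun q => by
    refine ⟨convex_stdSimplex ℝ A, fun p _ p' _ a b _ _ _ => le_of_eq ?_⟩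
    simp only [f, smul_eq_mul, Pi.add_apply, Pi.smul_apply, Finset.mul_sum,
      ← Finset.sum_add_distrib]
    exact Finset.sum_congr rfl fun x _ => Finset.sum_congr rfl fun y _ => by ring
  have hconc : ∀ p ∈ stdSimplex ℝ A, ConcaveOn ℝ (stdSimplex ℝ B) fun q => f p q := fun p hp => by
    refine ⟨convex_stdSimplex ℝ B, fun q _ q' _ a b ha hb hab => ?_⟩
    simp only [f, smul_eq_mul, Pi.add_apply, Pi.smul_apply, Finset.mul_sum,
      ← Finset.sum_add_distrib]
    refine Finset.sum_le_sum fun x _ => Finset.sum_le_sum fun y _ => ?_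
    have key : a * min (W x y) (l * q y) + b * min (W x y) (l * q' y)
        ≤ min (W x y) (l * (a * q y + b * q' y)) := by
      refine le_min ?_ ?_
      · calc _ ≤ a * W x y + b * W x y := by gcongr <;> exact min_le_left _ _
          _ = W x y := by rw [← add_mul, hab, one_mul]
      · calc _ ≤ a * (l * q y) + b * (l * q' y) := by gcongr <;> exact min_le_right _ _
          _ = _ := by ring
    nlinarith [mul_le_mul_of_nonneg_left key (hp.1 x)]
  obtain ⟨p, hp, q, hq, hpq⟩ := Sion.exists_isSaddlePointOn (f := f)
    (X := stdSimplex ℝ A) (Y := stdSimplex ℝ B) (Set.nonempty_coe_sort.1 inferInstance)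
    (convex_stdSimplex ℝ A) (isCompact_stdSimplex ℝ A)
    (fun q _ => (Continuous.lowerSemicontinuous (by fun_prop)).lowerSemicontinuousOn _)
    (fun q _ => (hconv q).quasiconvexOn)
    (convex_stdSimplex ℝ B) (Set.nonempty_coe_sort.1 inferInstance) (isCompact_stdSimplex ℝ B)
    (fun p _ => (Continuous.upperSemicontinuous (by fun_prop)).upperSemicontinuousOn _)
    (fun p hp => (hconc p hp).quasiconcaveOn)
  -- The hypothesis is used only at the saddle point's `q`: the value of `f` at `p` and any `Q` is
  -- at most its value at `P` and `q`.
  obtain ⟨P, hP⟩ := h ⟨q, hq⟩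
  exact ⟨⟨p, hp⟩, fun Q => (hpq P P.2 Q Q.2).trans hP⟩

theorem outputDist_nonneg {A B : Type*} [Fintype A] [Fintype B]
    (P : stdSimplex ℝ A) (W : Channel A B) (y : B) : 0 ≤ outputDist P W y :=
  Finset.sum_nonneg fun _ _ => mul_nonneg (stdSimplex.zero_le _ _) (stdSimplex.zero_le _ _)

theorem sum_outputDist {A B : Type*} [Fintype A] [Fintype B]
    (P : stdSimplex ℝ A) (W : Channel A B) : ∑ y, outputDist P W y = 1 := by
  unfold outputDist
  rw [Finset.sum_comm]
  simp only [← Finset.mul_sum, stdSimplex.sum_eq_one, mul_one]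

theorem mul_le_outputDist {A B : Type*} [Fintype A] [Fintype B]
    (P : stdSimplex ℝ A) (W : Channel A B) (x : A) (y : B) : P x * W x y ≤ outputDist P W y :=
  Finset.single_le_sum (f := fun x => P x * W x y)
    (fun _ _ => mul_nonneg (stdSimplex.zero_le _ _) (stdSimplex.zero_le _ _)) (Finset.mem_univ x)

/-- On the support of the joint distribution, the information density is at most `a` exactly when
`W ≤ exp (n a) * PW`. -/
theorem infoDensity_le_iff {A B : Type*} [Fintype A] [Fintype B]
    (P : stdSimplex ℝ A) (W : Channel A B) {n : ℕ} (hn : 0 < n) (a : ℝ) {x : A} {y : B}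
    (h : P x * W x y ≠ 0) :
    (1 / (n : ℝ)) * Real.log (W x y / outputDist P W y) ≤ a ↔
      W x y ≤ Real.exp (n * a) * outputDist P W y := by
  have hn' : (0 : ℝ) < n := by exact_mod_cast hn
  have hpos : 0 < P x * W x y :=
    lt_of_le_of_ne (mul_nonneg (stdSimplex.zero_le _ _) (stdSimplex.zero_le _ _)) h.symm
  have hW : 0 < W x y := lt_of_le_of_ne (stdSimplex.zero_le _ _) (right_ne_zero_of_mul h).symm
  have hPW : 0 < outputDist P W y := hpos.trans_le (mul_le_outputDist P W x y)
  rw [one_div, inv_mul_le_iff₀ hn', Real.log_le_iff_le_exp (div_pos hW hPW), div_le_iff₀ hPW]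

theorem infoDensityCDF_eq {A B : Type*} [Fintype A] [Fintype B]
    (P : stdSimplex ℝ A) (W : Channel A B) {n : ℕ} (hn : 0 < n) (a : ℝ) :
    infoDensityCDF P W n a = ∑ x, ∑ y,
      if W x y ≤ Real.exp (n * a) * outputDist P W y then P x * W x y else 0 := by
  refine Finset.sum_congr rfl fun x _ => Finset.sum_congr rfl fun y _ => ?_
  by_cases h : P x * W x y = 0
  · simp [h]
  · simp only [infoDensity_le_iff P W hn a h]

theorem infoDensityCDF_nonneg {A B : Type*} [Fintype A] [Fintype B]
    (P : stdSimplex ℝ A) (W : Channel A B) (n : ℕ) (a : ℝ) : 0 ≤ infoDensityCDF P W n a :=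
  Finset.sum_nonneg fun x _ => Finset.sum_nonneg fun y _ => by
    split_ifs
    exacts [mul_nonneg (stdSimplex.zero_le _ _) (stdSimplex.zero_le _ _), le_rfl]

/-- One-shot minimax converse for identification codes. -/
theorem IDCode.exists_infoDensityCDF_le {A B : Type*} [Fintype A] [Fintype B] [Nonempty A]
    {N : ℕ} (c : IDCode A B N) (W : Channel A B) {K : ℕ} (hK : 0 < K)
    (hN : Fintype.card A ^ K < N) {L : ℝ} (hL : 0 < L) {n : ℕ} (hn : 0 < n) (a : ℝ) :
    ∃ P : stdSimplex ℝ A, infoDensityCDF P W n a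
      ≤ c.errorI W + c.errorII W + 2 * √(L / K) + Real.exp (n * a) / L := by
  have : Nonempty B := by
    by_contra hB
    rw [not_nonempty_iff] at hB
    have := stdSimplex.sum_eq_one (W (Classical.arbitrary A))
    simp at this
  set l := Real.exp (n * a)
  have hl0 : 0 < l := Real.exp_pos _
  obtain ⟨P, hP⟩ := exists_forall_sum_min_le W (l := l)
    (κ := c.errorI W + c.errorII W + 2 * √(L / K) + l / L) fun Q => by
      obtain ⟨P, hP⟩ := c.exists_sum_ite_le W hK hN Q hL.le
      refine ⟨P, ?_⟩
      -- Beyond the truncation, `L * Q < W` gives `l * Q ≤ (l / L) * W`, at total cost `l / L`.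
      have hterm : ∀ x y, P x * min (W x y) (l * Q y)
          ≤ P x * (if W x y ≤ L * Q y then W x y else 0) + P x * (l / L * W x y) := fun x y => by
        rw [← mul_add]
        refine mul_le_mul_of_nonneg_left ?_ (stdSimplex.zero_le _ _)
        have h0 : 0 ≤ l / L * W x y :=
          mul_nonneg (div_pos hl0 hL).le (stdSimplex.zero_le _ _)
        split_ifs with h
        · exact (min_le_left _ _).trans (le_add_of_nonneg_right h0)
        · refine (min_le_right _ _).trans ?_
          rw [zero_add, div_mul_eq_mul_div, le_div_iff₀ hL]
          nlinarith
      have hsum : ∑ x, ∑ y, P x * (l / L * W x y) = l / L := by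
        simp only [← Finset.mul_sum, stdSimplex.sum_eq_one, ← Finset.sum_mul, mul_one, one_mul]
      calc _ ≤ ∑ x, ∑ y, (P x * (if W x y ≤ L * Q y then W x y else 0)
            + P x * (l / L * W x y)) :=
            Finset.sum_le_sum fun x _ => Finset.sum_le_sum fun y _ => hterm x y
        _ ≤ _ := by
          simp only [Finset.sum_add_distrib] at hP ⊢
          rw [hsum]
          linarith
  -- The minimax order permits `Q` to be the output law of `P` itself.
  refine ⟨P, le_trans ?_ (hP ⟨outputDist P W, outputDist_nonneg P W, sum_outputDist P W⟩)⟩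
  rw [infoDensityCDF_eq P W hn]
  refine Finset.sum_le_sum fun x _ => Finset.sum_le_sum fun y _ => ?_
  split_ifs with h
  · exact mul_le_mul_of_nonneg_left (le_min le_rfl h) (stdSimplex.zero_le _ _)
  · exact mul_nonneg (stdSimplex.zero_le _ _) (le_min (stdSimplex.zero_le _ _)
      (mul_nonneg hl0.le (outputDist_nonneg P W y)))

/-! ### One-shot direct part: Feinstein, Gilbert–Varshamov, identification -/

/-- Feinstein's lemma: `M` inputs with disjoint decoding sets, whose error probability is at most
the probability of `W ≤ θ * PW` plus `M / θ`. -/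
theorem exists_transmission_code {A B : Type*} [Fintype A] [Fintype B]
    (P : stdSimplex ℝ A) (W : Channel A B) {θ : ℝ} (hθ : 0 < θ) (M : ℕ) :
    ∃ (u : Fin M → A) (D : Fin M → Finset B), Pairwise (fun i j => Disjoint (D i) (D j)) ∧
      (∀ i, ∑ y ∈ D i, outputDist P W y ≤ 1 / θ) ∧
      ∀ i, 1 - ((∑ x, ∑ y, if W x y ≤ θ * outputDist P W y then P x * W x y else 0) + M / θ)
        ≤ ∑ y ∈ D i, W (u i) y := by
  classical
  set F := ∑ x, ∑ y, if W x y ≤ θ * outputDist P W y then P x * W x y else 0 with hF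
  induction M with
  | zero => exact ⟨Fin.elim0, Fin.elim0, fun i => i.elim0, fun i => i.elim0, fun i => i.elim0⟩
  | succ M ih =>
    obtain ⟨u, D, hdisj, hmass, herr⟩ := ih
    set U : Finset B := Finset.univ.biUnion D with hU
    -- Greedy extension: the outputs already used have small mass under the output law, so on
    -- average over `P` removing them costs little.
    have hUmass : ∑ y ∈ U, outputDist P W y ≤ M / θ := by
      rw [hU, Finset.sum_biUnion fun i _ j _ h => hdisj h]
      calc _ ≤ ∑ _i : Fin M, 1 / θ := Finset.sum_le_sum fun i _ => hmass i
        _ = M / θ := by simp [div_eq_mul_inv]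
    let E : A → Finset B := fun x =>
      Finset.univ.filter (fun y => ¬ W x y ≤ θ * outputDist P W y) \ U
    -- The sign turns "at most the mean" into an input whose success probability is at least the
    -- mean.
    obtain ⟨x, hx⟩ := stdSimplex.exists_le_sum_mul P fun x => -∑ y ∈ E x, W x y
    have hEx : ∀ x, 1 ≤ ∑ y ∈ E x, W x y + ∑ y, (if W x y ≤ θ * outputDist P W y then W x y else 0)
        + ∑ y ∈ U, W x y := fun x => by
      have h0 := Finset.sum_filter_add_sum_filter_not Finset.univ
        (fun y => W x y ≤ θ * outputDist P W y) (fun y => W x y)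
      rw [stdSimplex.sum_eq_one, Finset.sum_filter] at h0
      have h1 : ∑ y ∈ Finset.univ.filter (fun y => ¬ W x y ≤ θ * outputDist P W y), W x y
          ≤ ∑ y ∈ E x, W x y + ∑ y ∈ U, W x y := by
        rw [← Finset.sum_inter_add_sum_sdiff _ U, add_comm]
        exact add_le_add_right (Finset.sum_le_sum_of_subset_of_nonneg Finset.inter_subset_right
          fun y _ _ => stdSimplex.zero_le _ _) _
      linarith
    have havg : 1 - (F + M / θ) ≤ ∑ y ∈ E x, W x y := by
      have h1 : ∑ x, P x * 1 ≤ ∑ x, P x * (∑ y ∈ E x, W x y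
          + ∑ y, (if W x y ≤ θ * outputDist P W y then W x y else 0) + ∑ y ∈ U, W x y) :=
        Finset.sum_le_sum fun x _ => mul_le_mul_of_nonneg_left (hEx x) (stdSimplex.zero_le _ _)
      have h2 : ∑ x, P x * ∑ y ∈ U, W x y = ∑ y ∈ U, outputDist P W y := by
        unfold outputDist
        rw [Finset.sum_comm]
        simp only [Finset.mul_sum]
      have h3 : ∑ x, P x * ∑ y, (if W x y ≤ θ * outputDist P W y then W x y else 0) = F := by
        simp only [hF, Finset.mul_sum, mul_ite, mul_zero]
      simp only [mul_add, Finset.sum_add_distrib, h2, h3, mul_one, stdSimplex.sum_eq_one] at h1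
      simp only [mul_neg, Finset.sum_neg_distrib] at hx
      linarith
    have hEU : ∀ i, Disjoint (E x) (D i) := fun i =>
      Finset.sdiff_disjoint.mono_right (Finset.subset_biUnion_of_mem D (Finset.mem_univ i))
    refine ⟨Fin.cons x u, Fin.cons (E x) D, ?_, ?_, ?_⟩
    · intro i j hij
      induction i using Fin.cases with
      | zero =>
        induction j using Fin.cases with
        | zero => exact absurd rfl hij
        | succ j => simpa using hEU j
      | succ i =>
        induction j using Fin.cases with
        | zero => simpa using (hEU i).symm
        | succ j => simpa using hdisj fun h => hij (congrArg Fin.succ h)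
    · intro i
      induction i using Fin.cases with
      | zero =>
        rw [Fin.cons_zero, le_div_iff₀ hθ, Finset.sum_mul]
        calc ∑ y ∈ E x, outputDist P W y * θ ≤ ∑ y ∈ E x, W x y := Finset.sum_le_sum fun y hy => by
              have := (Finset.mem_filter.1 (Finset.mem_sdiff.1 hy).1).2
              linarith
          _ ≤ ∑ y, W x y := Finset.sum_le_sum_of_subset_of_nonneg (Finset.subset_univ _)
              fun y _ _ => stdSimplex.zero_le _ _
          _ = 1 := stdSimplex.sum_eq_one _
      | succ i => simpa using hmass i
    · have hM : (M : ℝ) / θ ≤ (M + 1 : ℕ) / θ := by gcongr; simp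
      intro i
      induction i using Fin.cases with
      | zero =>
        simp only [Fin.cons_zero]
        linarith
      | succ i =>
        simp only [Fin.cons_succ]
        linarith [herr i]

/-- Union bound over the `t`-sets of places where agreement is imposed: at most `2 ^ s` sets, each
leaving `s - t` free letters. -/
theorem card_agree_ge_le {s q t : ℕ} (f : Fin s → Fin q) :
    (Finset.univ.filter fun g : Fin s → Fin q =>
      t ≤ (Finset.univ.filter fun k => f k = g k).card).card ≤ 2 ^ s * q ^ (s - t) := by
  classical
  let S : Finset (Fin s) → Finset (Fin s → Fin q) := fun T =>
    Fintype.piFinset fun k => if k ∈ T then {f k} else Finset.univ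
  have hS : ∀ T ∈ Finset.powersetCard t (Finset.univ : Finset (Fin s)),
      (S T).card ≤ q ^ (s - t) := fun T hT => by
    rw [Fintype.card_piFinset]
    have h1 : ∀ k, (if k ∈ T then {f k} else (Finset.univ : Finset (Fin q))).card
        = if k ∈ T then 1 else q := fun k => by split_ifs <;> simp
    have h2 : (Finset.univ.filter fun k => k ∉ T).card = s - t := by
      rw [Finset.filter_not, Finset.filter_univ_mem, ← Finset.compl_eq_univ_sdiff,
        Finset.card_compl, Fintype.card_fin, (Finset.mem_powersetCard.1 hT).2]
    simp only [h1, Finset.prod_ite, Finset.prod_const_one, one_mul, Finset.prod_const, h2, le_refl]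
  have hsub : (Finset.univ.filter fun g : Fin s → Fin q =>
      t ≤ (Finset.univ.filter fun k => f k = g k).card)
      ⊆ (Finset.powersetCard t Finset.univ).biUnion S := fun g hg => by
    obtain ⟨T, hT, hTc⟩ := Finset.exists_subset_card_eq (Finset.mem_filter.1 hg).2
    refine Finset.mem_biUnion.2
      ⟨T, Finset.mem_powersetCard.2 ⟨Finset.subset_univ _, hTc⟩, Fintype.mem_piFinset.2 fun k => ?_⟩
    split_ifs with hk
    · exact Finset.mem_singleton.2 (Finset.mem_filter.1 (hT hk)).2.symm
    · exact Finset.mem_univ _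
  calc _ ≤ _ := Finset.card_le_card hsub
    _ ≤ (Finset.powersetCard t (Finset.univ : Finset (Fin s))).card * q ^ (s - t) :=
      Finset.card_biUnion_le_card_mul _ _ _ hS
    _ ≤ 2 ^ s * q ^ (s - t) := by
      gcongr
      rw [Finset.card_powersetCard, Finset.card_univ, Fintype.card_fin]
      exact Nat.choose_le_two_pow s t

/-- Gilbert–Varshamov: a large family of words of length `s` over `q` letters, any two of which
agree in fewer than `t` places. -/
theorem exists_gilbert_varshamov {s q t : ℕ} (hq : 0 < q) (hts : t ≤ s) :
    ∃ C : Finset (Fin s → Fin q), (∀ f ∈ C, ∀ g ∈ C, f ≠ g →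
      (Finset.univ.filter fun k => f k = g k).card < t) ∧ q ^ t ≤ 2 ^ s * C.card := by
  classical
  obtain ⟨C, hC⟩ := (Set.toFinite {C : Finset (Fin s → Fin q) | ∀ f ∈ C, ∀ g ∈ C, f ≠ g →
    (Finset.univ.filter fun k => f k = g k).card < t}).exists_maximal ⟨∅, by simp⟩
  refine ⟨C, hC.prop, ?_⟩
  -- An uncovered word could be added to the maximal code. It is not already in it, since it agrees
  -- with itself in all `s ≥ t` places.
  have hcover : (Finset.univ : Finset (Fin s → Fin q)) ⊆ C.biUnion fun f =>
      Finset.univ.filter fun g => t ≤ (Finset.univ.filter fun k => f k = g k).card := fun g _ => by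
    by_contra hg
    simp only [Finset.mem_biUnion, Finset.mem_filter, Finset.mem_univ, true_and, not_exists,
      not_and, not_le] at hg
    have hgC : g ∉ C := fun h => by
      have := hg g h
      simp only [Finset.filter_true, Finset.card_univ, Fintype.card_fin] at this
      omega
    refine hgC (hC.le_of_ge (y := insert g C) ?_ (Finset.subset_insert g C)
      (Finset.mem_insert_self g C))
    intro f hf f' hf' hne
    rcases Finset.mem_insert.1 hf with h | h <;> rcases Finset.mem_insert.1 hf' with h' | h'
    · exact absurd (h.trans h'.symm) hne
    · rw [h]
      simpa only [eq_comm] using hg f' h'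
    · rw [h']
      exact hg f h
    · exact hC.prop f h f' h' hne
  have hcard := (Finset.card_le_card hcover).trans
    (Finset.card_biUnion_le_card_mul _ _ _ fun f _ => card_agree_ge_le f)
  rw [Finset.card_univ, Fintype.card_fun, Fintype.card_fin, Fintype.card_fin] at hcard
  refine Nat.le_of_mul_le_mul_right ?_ (pow_pos hq (s - t))
  calc q ^ t * q ^ (s - t) = q ^ s := by rw [← pow_add, Nat.add_sub_cancel' hts]
    _ ≤ _ := hcard
    _ = _ := by ring

/-- The distribution of `v k` for a uniformly distributed index `k`. -/
noncomputable def uniformOn {A : Type*} [Fintype A] {s : ℕ} (hs : 0 < s) (v : Fin s → A) :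
    stdSimplex ℝ A := by
  classical
  exact ⟨fun x => (∑ k, if v k = x then 1 else 0) / s,
    fun x => div_nonneg (Finset.sum_nonneg fun k _ => by split_ifs <;> norm_num) (by positivity), by
      rw [← Finset.sum_div, Finset.sum_comm]
      simp only [Finset.sum_ite_eq, Finset.mem_univ, if_true, Finset.sum_const, Finset.card_univ,
        Fintype.card_fin, nsmul_eq_mul, mul_one]
      exact div_self (by exact_mod_cast hs.ne')⟩

theorem sum_uniformOn_mul {A : Type*} [Fintype A] {s : ℕ} (hs : 0 < s) (v : Fin s → A)
    (g : A → ℝ) : ∑ x, uniformOn hs v x * g x = (∑ k, g (v k)) / s := by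
  classical
  have h : ∀ x, uniformOn hs v x = (∑ k, if v k = x then 1 else 0) / s := fun x => by
    unfold uniformOn
    simp only [DFunLike.coe]
  simp only [h, div_mul_eq_mul_div, Finset.sum_mul, ite_mul, one_mul, zero_mul]
  rw [← Finset.sum_div, Finset.sum_comm]
  simp

/-- Identification from transmission: a code of words over `q` letters turns a transmission code
with `s * q` messages into an identification code. -/
theorem exists_idCode_of_transmission {A B : Type*} [Fintype A] [Fintype B] (W : Channel A B)
    {s q t : ℕ} (hs : 0 < s) (hq : 0 < q) (ht : 0 < t) (hts : t ≤ s)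
    (u : Fin s × Fin q → A) (D : Fin s × Fin q → Finset B)
    (hdisj : Pairwise (fun i j => Disjoint (D i) (D j))) {ε : ℝ} (hε : 0 ≤ ε)
    (herr : ∀ i, 1 - ε ≤ ∑ y ∈ D i, W (u i) y) :
    ∃ (N : ℕ) (c : IDCode A B N), q ^ t ≤ 2 ^ s * N ∧ c.errorI W ≤ ε ∧
      c.errorII W ≤ (t - 1) / s + ε := by
  classical
  obtain ⟨C, hC, hcard⟩ := exists_gilbert_varshamov hq hts
  have hs' : (0 : ℝ) < s := by exact_mod_cast hs
  have ht1 : (1 : ℝ) ≤ t := by exact_mod_cast ht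
  let f : Fin C.card → Fin s → Fin q := fun i => (C.equivFin.symm i : Fin s → Fin q)
  have hf : ∀ i j, i ≠ j → (Finset.univ.filter fun k => f i k = f j k).card < t := fun i j hij =>
    hC _ (C.equivFin.symm i).2 _ (C.equivFin.symm j).2 fun h =>
      hij (C.equivFin.symm.injective (Subtype.ext h))
  let c : IDCode A B C.card :=
    { encoder := fun i => uniformOn hs fun k => u (k, f i k)
      decodingSet := fun i => Finset.univ.biUnion fun k => D (k, f i k) }
  have hacc : ∀ i j, c.acceptProb W i j
      = (∑ k, ∑ y ∈ c.decodingSet i, W (u (k, f j k)) y) / s := fun i j =>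
    sum_uniformOn_mul hs _ fun x => ∑ y ∈ c.decodingSet i, W x y
  have hle1 : ∀ x (E : Finset B), ∑ y ∈ E, W x y ≤ 1 := fun x E => by
    rw [← stdSimplex.sum_eq_one (W x)]
    exact Finset.sum_le_sum_of_subset_of_nonneg (Finset.subset_univ _)
      fun y _ _ => stdSimplex.zero_le _ _
  refine ⟨C.card, c, hcard, ?_, ?_⟩
  · refine Real.iSup_le (fun i => ?_) hε
    rw [hacc, sub_le_comm, le_div_iff₀ hs']
    calc (1 - ε) * s = ∑ _k : Fin s, (1 - ε) := by simp; ring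
      _ ≤ _ := Finset.sum_le_sum fun k _ => (herr _).trans <|
        Finset.sum_le_sum_of_subset_of_nonneg
          (Finset.subset_biUnion_of_mem (fun k => D (k, f i k)) (Finset.mem_univ k))
          fun y _ _ => stdSimplex.zero_le _ _
  -- Nonnegativity of the bound covers the case of no pairs, where the supremum is 0 by default.
  · refine Real.iSup_le (fun p => ?_) (add_nonneg (div_nonneg (by linarith) hs'.le) hε)
    obtain ⟨⟨i, j⟩, hij⟩ := p
    simp only at hij ⊢
    rw [hacc, div_add' _ _ _ hs'.ne', div_le_div_iff_of_pos_right hs']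
    have hk : ∀ k, ∑ y ∈ c.decodingSet i, W (u (k, f j k)) y
        ≤ (if f i k = f j k then 1 else 0) + ε := fun k => by
      split_ifs with h
      · linarith [hle1 (u (k, f j k)) (c.decodingSet i)]
      -- If the letters at `k` differ, the pair `(k, f j k)` is none of those in the union for `i`,
      -- so only the transmission error can leak.
      · have hd : Disjoint (D (k, f j k)) (c.decodingSet i) := by
          refine (Finset.disjoint_biUnion_right _ _ _).2 fun k' _ => hdisj fun h' => h ?_
          rw [Prod.mk.injEq] at h'
          rw [h'.2, h'.1]
        have h1 := hle1 (u (k, f j k)) (D (k, f j k) ∪ c.decodingSet i)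
        rw [Finset.sum_union hd] at h1
        linarith [herr (k, f j k)]
    calc _ ≤ ∑ k, ((if f i k = f j k then 1 else 0) + ε) := Finset.sum_le_sum fun k _ => hk k
      _ = (Finset.univ.filter fun k => f i k = f j k).card + ε * s := by
        rw [Finset.sum_add_distrib]
        simp [mul_comm]
      _ ≤ t - 1 + ε * s := by
        have : ((Finset.univ.filter fun k => f i k = f j k).card : ℝ) + 1 ≤ t := by
          exact_mod_cast hf i j hij
        linarith

/-- One-shot direct part: an identification code from the information spectrum. -/
theorem exists_idCode {A B : Type*} [Fintype A] [Fintype B] (P : stdSimplex ℝ A) (W : Channel A B)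
    {n : ℕ} (hn : 0 < n) (a : ℝ) {s q t : ℕ} (hs : 0 < s) (hq : 0 < q) (ht : 0 < t) (hts : t ≤ s) :
    ∃ (N : ℕ) (c : IDCode A B N), q ^ t ≤ 2 ^ s * N ∧
      c.errorI W ≤ infoDensityCDF P W n a + s * q / Real.exp (n * a) ∧
      c.errorII W ≤ (t - 1) / s + (infoDensityCDF P W n a + s * q / Real.exp (n * a)) := by
  obtain ⟨u, D, hdisj, -, herr⟩ := exists_transmission_code P W (Real.exp_pos (n * a)) (s * q)
  rw [← infoDensityCDF_eq P W hn] at herr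
  push_cast at herr
  exact exists_idCode_of_transmission W hs hq ht hts (u ∘ finProdFinEquiv) (D ∘ finProdFinEquiv)
    (fun i j hij => hdisj (finProdFinEquiv.injective.ne hij))
    (add_nonneg (infoDensityCDF_nonneg P W n a) (by positivity)) fun i => herr _

/-! ### Asymptotics of the direct part -/

theorem EReal.coe_le_of_forall_sub_mul_le {R b k : ℝ} {x : EReal} (hb : 0 < b)
    (h : ∀ γ : ℝ, 0 < γ → γ < b → ((R - k * γ : ℝ) : EReal) ≤ x) : (R : EReal) ≤ x := by
  have hlim : Tendsto (fun γ : ℝ => ((R - k * γ : ℝ) : EReal)) (𝓝[>] 0) (𝓝 (R : EReal)) := by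
    refine (continuous_coe_real_ereal.tendsto R).comp (tendsto_nhdsWithin_of_tendsto_nhds ?_)
    have : Continuous fun γ : ℝ => R - k * γ := by fun_prop
    simpa using this.tendsto 0
  exact le_of_tendsto hlim (by
    filter_upwards [Ioo_mem_nhdsGT hb] with γ hγ using h γ hγ.1 hγ.2)

theorem tendsto_exp_neg_natCast_mul {γ : ℝ} (hγ : 0 < γ) :
    Tendsto (fun n : ℕ => Real.exp (-(n * γ))) atTop (𝓝 0) :=
  Real.tendsto_exp_neg_atTop_nhds_zero.comp (tendsto_natCast_atTop_atTop.atTop_mul_const hγ)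

theorem exists_trivial_idCode {A B : Type*} [Fintype A] [Fintype B] [Nonempty A]
    (W : Channel A B) : ∃ c : IDCode A B 1, c.errorI W ≤ 0 ∧ c.errorII W ≤ 0 := by
  refine ⟨⟨fun _ => Classical.arbitrary _, fun _ => Finset.univ⟩,
    Real.iSup_le (fun i => ?_) le_rfl, Real.iSup_le (fun p => ?_) le_rfl⟩
  · simp [IDCode.acceptProb]
  · exact absurd (Subsingleton.elim _ _) p.2

/-- Achievability asks for a code at every block length; the finitely many exceptions get the
one-message code, which the limits do not see. -/
theorem idAchievable_of_eventually {X Y : Type*} [Fintype X] [Nonempty X] [Fintype Y]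
    (W : GeneralChannel X Y) {R : ℝ} {e₁ e₂ : ℕ → ℝ} (he₁ : Tendsto e₁ atTop (𝓝 0))
    (he₂ : Tendsto e₂ atTop (𝓝 0))
    (h : ∀ᶠ n in atTop, ∃ (N : ℕ) (c : IDCode (Fin n → X) (Fin n → Y) N), 1 ≤ N ∧
      c.errorI (W n) ≤ e₁ n ∧ c.errorII (W n) ≤ e₂ n ∧ R ≤ idRate n N) :
    IDAchievable 0 0 W R := by
  have hall : ∀ n, ∃ (N : ℕ) (c : IDCode (Fin n → X) (Fin n → Y) N), 1 ≤ N ∧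
      ((∃ (N : ℕ) (c : IDCode (Fin n → X) (Fin n → Y) N), 1 ≤ N ∧
        c.errorI (W n) ≤ e₁ n ∧ c.errorII (W n) ≤ e₂ n ∧ R ≤ idRate n N) →
      c.errorI (W n) ≤ e₁ n ∧ c.errorII (W n) ≤ e₂ n ∧ R ≤ idRate n N) := fun n => by
    by_cases hn : ∃ (N : ℕ) (c : IDCode (Fin n → X) (Fin n → Y) N), 1 ≤ N ∧
        c.errorI (W n) ≤ e₁ n ∧ c.errorII (W n) ≤ e₂ n ∧ R ≤ idRate n N
    · obtain ⟨N, c, hN, hc⟩ := hn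
      exact ⟨N, c, hN, fun _ => hc⟩
    · obtain ⟨c, -⟩ := exists_trivial_idCode (W n)
      exact ⟨1, c, le_rfl, fun h => absurd h hn⟩
  choose N c hN hc using hall
  have hlim : ∀ e : ℕ → ℝ, Tendsto e atTop (𝓝 0) →
      limsup (fun n => ((e n : ℝ) : EReal)) atTop = ((0 : ℝ) : EReal) := fun e he =>
    ((continuous_coe_real_ereal.tendsto 0).comp he).limsup_eq
  refine ⟨N, c, hN, ?_, ?_, ?_⟩
  · rw [← hlim e₁ he₁]
    exact limsup_le_limsup (h.mono fun n hn => EReal.coe_le_coe_iff.2 (hc n hn).1)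
  · rw [← hlim e₂ he₂]
    exact limsup_le_limsup (h.mono fun n hn => EReal.coe_le_coe_iff.2 (hc n hn).2.1)
  · exact le_liminf_of_le (h := h.mono fun n hn => EReal.coe_le_coe_iff.2 (hc n hn).2.2)

theorem idAchievable_zero {X Y : Type*} [Fintype X] [Nonempty X] [Fintype Y]
    (W : GeneralChannel X Y) : IDAchievable 0 0 W 0 :=
  idAchievable_of_eventually W tendsto_const_nhds tendsto_const_nhds <| .of_forall fun n => by
    obtain ⟨c, h₁, h₂⟩ := exists_trivial_idCode (W n)
    exact ⟨1, c, le_rfl, h₁, h₂, by simp [idRate]⟩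

theorem Real.half_le_natFloor {x : ℝ} (hx : 1 ≤ x) : x / 2 ≤ ⌊x⌋₊ := by
  have h1 : (1 : ℝ) ≤ ⌊x⌋₊ := by exact_mod_cast (Nat.one_le_floor_iff x).2 hx
  linarith [Nat.lt_floor_add_one x]

/-- The agreement fraction `log 4 / log q` is what makes `q ^ t ≥ 4 ^ s`; the Gilbert–Varshamov loss
`2 ^ s` then leaves `2 ^ s` messages. -/
theorem Nat.two_pow_le_of_pow_le {s q t N : ℕ} (hq : 2 ≤ q)
    (ht : s * (Real.log 4 / Real.log q) ≤ t) (h : q ^ t ≤ 2 ^ s * N) : 2 ^ s ≤ N := by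
  have hq' : (1 : ℝ) < q := by exact_mod_cast hq
  have hlog : 0 < Real.log q := Real.log_pos hq'
  have h1 : (4 : ℝ) ^ s ≤ (q : ℝ) ^ t := by
    rw [← Real.log_le_log_iff (by positivity) (by positivity), Real.log_pow, Real.log_pow]
    rwa [← mul_div_assoc, div_le_iff₀ hlog] at ht
  have h2 : 4 ^ s ≤ q ^ t := by exact_mod_cast h1
  refine Nat.le_of_mul_le_mul_left ?_ (pow_pos (zero_lt_two' ℕ) s)
  rw [← mul_pow]
  exact h2.trans h

theorem idAchievable_of_tendsto {X Y : Type*} [Fintype X] [Nonempty X] [Fintype Y]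
    (W : GeneralChannel X Y) (P : InputSequence X) {a γ : ℝ} (hγ : 0 < γ) (hγa : γ < a / 2)
    (h : Tendsto (fun n : ℕ => infoDensityCDF (P n) (W n) n a) atTop (𝓝 0)) :
    IDAchievable 0 0 W (a - 3 * γ) := by
  -- The product `s * q` stays a factor `exp (n * γ)` below the Feinstein threshold `exp (n * a)`,
  -- while `q → ∞` drives the agreement fraction to 0.
  let q : ℕ → ℕ := fun n => ⌊Real.exp (n * γ)⌋₊
  let s : ℕ → ℕ := fun n => ⌊Real.exp (n * (a - 2 * γ))⌋₊
  have hnγ : Tendsto (fun n : ℕ => (n : ℝ) * γ) atTop atTop :=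
    tendsto_natCast_atTop_atTop.atTop_mul_const hγ
  have hq : Tendsto q atTop atTop := tendsto_nat_floor_atTop.comp (Real.tendsto_exp_atTop.comp hnγ)
  have hτ : Tendsto (fun n => Real.log 4 / Real.log (q n)) atTop (𝓝 0) :=
    (Real.tendsto_log_atTop.comp (tendsto_natCast_atTop_atTop.comp hq)).const_div_atTop _
  have he : Tendsto (fun n : ℕ => infoDensityCDF (P n) (W n) n a + Real.exp (-(n * γ)))
      atTop (𝓝 0) := by
    simpa using h.add (tendsto_exp_neg_natCast_mul hγ)
  refine idAchievable_of_eventually W he (e₂ := fun n => Real.log 4 / Real.log (q n)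
    + (infoDensityCDF (P n) (W n) n a + Real.exp (-(n * γ)))) (by simpa using hτ.add he) ?_
  -- `q ≥ 4` ensures `t ≤ s`; the last condition absorbs `log (log 2 / 2)`, the constant left by the
  -- floor in `s` and by `N ≥ 2 ^ s`.
  filter_upwards [hq.eventually_ge_atTop 4, eventually_gt_atTop 0,
    hnγ.eventually_ge_atTop (-Real.log (Real.log 2 / 2))] with n hqn hn hnγ'
  have hn' : (0 : ℝ) < n := by exact_mod_cast hn
  have hexp : 1 ≤ Real.exp (n * (a - 2 * γ)) := Real.one_le_exp (by nlinarith)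
  have hsn : 0 < s n := (Nat.one_le_floor_iff _).2 hexp
  have hsn' : (0 : ℝ) < s n := by exact_mod_cast hsn
  have hq4 : (4 : ℝ) ≤ q n := by exact_mod_cast hqn
  have hlog4 : 0 < Real.log 4 := Real.log_pos (by norm_num)
  have hlogq : Real.log 4 ≤ Real.log (q n) := Real.log_le_log (by norm_num) hq4
  set τ := Real.log 4 / Real.log (q n) with hτdef
  have hτ0 : 0 < τ := div_pos hlog4 (hlog4.trans_le hlogq)
  have hτ1 : τ ≤ 1 := (div_le_one (hlog4.trans_le hlogq)).2 hlogq
  set t := ⌈s n * τ⌉₊ with ht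
  have ht0 : 0 < t := Nat.ceil_pos.2 (mul_pos hsn' hτ0)
  have hts : t ≤ s n := Nat.ceil_le.2 (mul_le_of_le_one_right hsn'.le hτ1)
  obtain ⟨N, c, hN, hI, hII⟩ := exists_idCode (P n) (W n) hn a hsn (by omega : 0 < q n) ht0 hts
  have hNs : 2 ^ s n ≤ N := Nat.two_pow_le_of_pow_le (by omega) (Nat.le_ceil _) hN
  have herr : s n * q n / Real.exp (n * a) ≤ Real.exp (-(n * γ)) := by
    rw [div_le_iff₀ (Real.exp_pos _)]
    calc (s n * q n : ℝ) ≤ Real.exp (n * (a - 2 * γ)) * Real.exp (n * γ) := by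
          gcongr
          exacts [Nat.floor_le (Real.exp_pos _).le, Nat.floor_le (Real.exp_pos _).le]
      _ = Real.exp (-(n * γ)) * Real.exp (n * a) := by
          rw [← Real.exp_add, ← Real.exp_add]
          ring_nf
  have hagree : ((t : ℝ) - 1) / s n ≤ τ := by
    rw [div_le_iff₀ hsn']
    linarith [Nat.ceil_lt_add_one (mul_pos hsn' hτ0).le]
  have hlog2 : 0 < Real.log 2 := Real.log_pos (by norm_num)
  have hN0 : (0 : ℝ) < 2 ^ s n := by positivity
  have hlogN : Real.exp (n * (a - 2 * γ)) * (Real.log 2 / 2) ≤ Real.log N := by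
    calc _ = Real.exp (n * (a - 2 * γ)) / 2 * Real.log 2 := by ring
      _ ≤ s n * Real.log 2 := by gcongr; exact Real.half_le_natFloor hexp
      _ = Real.log (2 ^ s n) := by rw [Real.log_pow]
      _ ≤ Real.log N := Real.log_le_log hN0 (by exact_mod_cast hNs)
  refine ⟨N, c, Nat.one_le_two_pow.trans hNs, by linarith, by linarith, ?_⟩
  rw [idRate, one_div, le_inv_mul_iff₀ hn']
  have hll := Real.log_le_log (by positivity) hlogN
  rw [Real.log_mul (Real.exp_pos _).ne' (by positivity), Real.log_exp] at hll
  linarith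

theorem spectralInfMutualInfo_le_idCapacity {X Y : Type*} [Fintype X] [Nonempty X] [Fintype Y]
    (W : GeneralChannel X Y) (P : InputSequence X) :
    spectralInfMutualInfo P W ≤ idCapacity W := by
  refine sSup_le ?_
  rintro _ ⟨a, ha, rfl⟩
  rcases le_or_gt a 0 with h0 | h0
  · exact le_sSup_of_le ⟨0, idAchievable_zero W, rfl⟩ (EReal.coe_le_coe_iff.2 h0)
  · exact EReal.coe_le_of_forall_sub_mul_le (half_pos h0) fun γ hγ hγa =>
      le_sSup ⟨_, idAchievable_of_tendsto W P hγ hγa ha, rfl⟩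

/-! ### Asymptotics of the converse -/

/-- A deterministic input has information density 0. This handles the nonpositive achievable rates.
-/
theorem coe_le_iSup_spectralInfMutualInfo_of_neg {X Y : Type*} [Fintype X] [Nonempty X]
    [Fintype Y] (W : GeneralChannel X Y) {a : ℝ} (ha : a < 0) :
    (a : EReal) ≤ ⨆ P : InputSequence X, spectralInfMutualInfo P W := by
  classical
  let P : InputSequence X := fun n => stdSimplex.vertex (Classical.arbitrary (Fin n → X))
  refine le_iSup_of_le P (le_sSup ⟨a, ?_, rfl⟩)
  refine tendsto_const_nhds.congr fun n => Eq.symm ?_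
  refine Finset.sum_eq_zero fun x _ => Finset.sum_eq_zero fun y _ => ?_
  have hout : outputDist (P n) (W n) y = W n (Classical.arbitrary (Fin n → X)) y := by
    simp [outputDist, P, Pi.single_apply]
  by_cases hx : x = Classical.arbitrary (Fin n → X)
  · rw [if_neg]
    rw [hout, hx, not_le]
    -- At an output of probability zero the density is still 0, by `0 / 0 = 0` and `Real.log 0 = 0`.
    by_cases h0 : W n (Classical.arbitrary (Fin n → X)) y = 0
    · simpa [h0] using ha
    · simpa [div_self h0] using ha
  · simp [P, hx]

/-- The logarithm of the number of words is `K * n * log (card X)`, and the exponential gap `exp (n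
* γ)` swallows the factor linear in `n`. -/
theorem card_pow_lt_of_exp_lt_log {X : Type*} [Fintype X] [Nonempty X] {n K N : ℕ} {b γ : ℝ}
    (hN : 1 ≤ N) (hb : 0 ≤ b) (hK : K ≤ Real.exp b + 1)
    (hn : 4 * Real.log (Fintype.card X) ≤ n * γ ^ 2) (hnγ : 0 ≤ n * γ)
    (hlog : Real.exp (b + n * γ) < Real.log N) : Fintype.card (Fin n → X) ^ K < N := by
  have hX : (1 : ℝ) ≤ Fintype.card X := by exact_mod_cast Fintype.card_pos
  have hlogX : 0 ≤ Real.log (Fintype.card X) := Real.log_nonneg hX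
  have hK2 : (K : ℝ) ≤ 2 * Real.exp b := by linarith [Real.one_le_exp hb]
  have hquad : n * γ * (n * γ) ≤ 2 * Real.exp (n * γ) := by
    nlinarith [Real.quadratic_le_exp_of_nonneg hnγ]
  have h1 : 2 * (n * Real.log (Fintype.card X)) ≤ Real.exp (n * γ) := by
    have : (n : ℝ) * (4 * Real.log (Fintype.card X)) ≤ n * (n * γ ^ 2) := by gcongr
    nlinarith
  have h2 : Real.log ((Fintype.card (Fin n → X) : ℝ) ^ K) < Real.log N := by
    refine lt_of_le_of_lt ?_ hlog
    rw [Fintype.card_fun, Fintype.card_fin, Nat.cast_pow, Real.log_pow, Real.log_pow]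
    calc (K : ℝ) * (n * Real.log (Fintype.card X))
        ≤ 2 * Real.exp b * (n * Real.log (Fintype.card X)) := by gcongr
      _ = Real.exp b * (2 * (n * Real.log (Fintype.card X))) := by ring
      _ ≤ Real.exp b * Real.exp (n * γ) := by gcongr
      _ = Real.exp (b + n * γ) := by rw [Real.exp_add]
  have h3 := (Real.log_lt_log_iff (by
    have : 0 < Fintype.card (Fin n → X) := Fintype.card_pos
    positivity) (by exact_mod_cast hN)).1 h2
  exact_mod_cast h3

theorem IDAchievable.exists_tendsto {X Y : Type*} [Fintype X] [Nonempty X] [Fintype Y]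
    {W : GeneralChannel X Y} {R γ : ℝ} (h : IDAchievable 0 0 W R) (hγ : 0 < γ) (hγR : γ < R / 2) :
    ∃ P : InputSequence X,
      Tendsto (fun n : ℕ => infoDensityCDF (P n) (W n) n (R - 4 * γ)) atTop (𝓝 0) := by
  obtain ⟨N, c, hN, hI, hII, hR⟩ := h
  let r : ℕ → ℝ := fun n => 2 * √(Real.exp (-(n * γ))) + Real.exp (-(n * γ))
  have hr : Tendsto r atTop (𝓝 0) := by
    have h0 := tendsto_exp_neg_natCast_mul hγ
    simpa using (h0.sqrt.const_mul 2).add h0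
  have hrate : ∀ᶠ n in atTop, R - γ < idRate n (N n) :=
    (eventually_lt_of_lt_liminf (lt_of_lt_of_le (EReal.coe_lt_coe_iff.2 (sub_lt_self R hγ)) hR)).mono
      fun n hn => EReal.coe_lt_coe_iff.1 hn
  have hbound : ∀ᶠ n in atTop, ∃ P : stdSimplex ℝ (Fin n → X),
      infoDensityCDF P (W n) n (R - 4 * γ) ≤ (c n).errorI (W n) + (c n).errorII (W n) + r n := by
    filter_upwards [hrate, eventually_gt_atTop 0,
      (tendsto_natCast_atTop_atTop.atTop_mul_const (pow_pos hγ 2)).eventually_ge_atTop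
        (4 * Real.log (Fintype.card X))] with n hrn hn hnX
    have hn' : (0 : ℝ) < n := by exact_mod_cast hn
    rw [idRate, one_div, lt_inv_mul_iff₀ hn'] at hrn
    -- A single message has rate 0 by `Real.log 0 = 0`, which is below `R - γ`.
    have hlogN : 0 < Real.log (N n) := by
      refine lt_of_le_of_ne (Real.log_natCast_nonneg _) fun h0 => ?_
      rw [← h0, Real.log_zero] at hrn
      nlinarith
    rw [Real.lt_log_iff_exp_lt hlogN] at hrn
    -- Exponents step down by `γ`: `R - γ` for `log N`, `R - 2 * γ` for `K`, `R - 3 * γ` for `L`, `R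
    -- - 4 * γ` for the density level. Thus `L / K` and `exp (n * a) / L` are at most `exp (-(n *
    -- γ))`.
    set b := n * (R - 2 * γ) with hb
    have hb0 : 0 ≤ b := mul_nonneg hn'.le (by linarith)
    set K := ⌈Real.exp b⌉₊ with hK
    have hK0 : 0 < K := Nat.ceil_pos.2 (Real.exp_pos _)
    have hcard : Fintype.card (Fin n → X) ^ K < N n :=
      card_pow_lt_of_exp_lt_log (hN n) hb0 (Nat.ceil_lt_add_one (Real.exp_pos _).le).le hnX
        (by positivity) (by rwa [hb, ← mul_add, show R - 2 * γ + γ = R - γ by ring])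
    obtain ⟨P, hP⟩ := (c n).exists_infoDensityCDF_le (W n) hK0 hcard
      (Real.exp_pos (n * (R - 3 * γ))) hn (R - 4 * γ)
    refine ⟨P, hP.trans ?_⟩
    have h1 : Real.exp (n * (R - 3 * γ)) / K ≤ Real.exp (-(n * γ)) := by
      rw [div_le_iff₀ (by exact_mod_cast hK0)]
      calc Real.exp (n * (R - 3 * γ)) = Real.exp (-(n * γ)) * Real.exp b := by
            rw [← Real.exp_add, hb]
            ring_nf
        _ ≤ _ := by gcongr; exact Nat.le_ceil _
    have h2 : Real.exp (n * (R - 4 * γ)) / Real.exp (n * (R - 3 * γ)) = Real.exp (-(n * γ)) := by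
      rw [← Real.exp_sub]
      ring_nf
    rw [h2]
    have := Real.sqrt_le_sqrt h1
    simp only [r]
    linarith
  have hall : ∀ n, ∃ P : stdSimplex ℝ (Fin n → X), (∃ P : stdSimplex ℝ (Fin n → X),
      infoDensityCDF P (W n) n (R - 4 * γ) ≤ (c n).errorI (W n) + (c n).errorII (W n) + r n) →
      infoDensityCDF P (W n) n (R - 4 * γ) ≤ (c n).errorI (W n) + (c n).errorII (W n) + r n :=
    fun n => by
      by_cases hn : ∃ P : stdSimplex ℝ (Fin n → X), infoDensityCDF P (W n) n (R - 4 * γ)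
          ≤ (c n).errorI (W n) + (c n).errorII (W n) + r n
      · exact ⟨hn.choose, fun _ => hn.choose_spec⟩
      · exact ⟨Classical.arbitrary _, fun h => absurd h hn⟩
  choose P hP using hall
  refine ⟨P, tendsto_order.2 ⟨fun e he => .of_forall fun n =>
    he.trans_le (infoDensityCDF_nonneg _ _ _ _), fun e he => ?_⟩⟩
  have hsmall : ∀ f : ℕ → ℝ, limsup (fun n => ((f n : ℝ) : EReal)) atTop ≤ ((0 : ℝ) : EReal) →
      ∀ᶠ n in atTop, f n < e / 3 := fun f hf =>
    (eventually_lt_of_limsup_lt (hf.trans_lt (EReal.coe_lt_coe_iff.2 (by linarith)))).mono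
      fun n hn => EReal.coe_lt_coe_iff.1 hn
  filter_upwards [hbound, hsmall _ hI, hsmall _ hII,
    hr.eventually_lt_const (by linarith : 0 < e / 3)] with n hn h1 h2 h3
  linarith [hP n hn]

theorem idCapacity_le_iSup_spectralInfMutualInfo {X Y : Type*} [Fintype X] [Nonempty X]
    [Fintype Y] (W : GeneralChannel X Y) :
    idCapacity W ≤ ⨆ P : InputSequence X, spectralInfMutualInfo P W := by
  refine sSup_le ?_
  rintro _ ⟨R, hR, rfl⟩
  rcases le_or_gt R 0 with h0 | h0
  · exact EReal.coe_le_of_forall_sub_mul_le (k := 1) one_pos fun γ hγ _ =>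
      coe_le_iSup_spectralInfMutualInfo_of_neg W (by linarith)
  · refine EReal.coe_le_of_forall_sub_mul_le (k := 4) (half_pos h0) fun γ hγ hγR => ?_
    obtain ⟨P, hP⟩ := hR.exists_tendsto hγ hγR
    exact le_iSup_of_le P (le_sSup ⟨_, hP, rfl⟩)

theorem mainTheorem2 {X Y : Type*} [Fintype X] [Nonempty X] [Fintype Y]
    (W : GeneralChannel X Y) :
    idCapacity W = ⨆ P : InputSequence X, spectralInfMutualInfo P W :=
  le_antisymm (idCapacity_le_iSup_spectralInfMutualInfo W)
    (iSup_le (spectralInfMutualInfo_le_idCapacity W))
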